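/- Let $n$ be a positive integer. For a Lie algebra $\mathfrak g$ of finite dimension over $\mathbb C$, put $\operatorname{ind}(\mathfrak g)=\min_{f\in\mathfrak g^*}\dim\ker B_f$, where $B_f(x,y)=f([x,y])$. For compositions $a_1|\cdots|a_m$ and $b_1|\cdots|b_t$ of $n$, the seaweed of type $\frac{a_1|\cdots|a_m}{b_1|\cdots|b_t}$ is the Lie algebra of all matrices in $\mathfrak{sl}(n,\mathbb C)$ that preserve the subspaces $\operatorname{span}\{e_1,\dots,e_{a_1+\cdots+a_i}\}$ ($0\le i\le m$) and $\operatorname{span}\{e_{b_1+\cdots+b_j+1},\dots,e_n\}$ ($0\le j\le t$) of $\mathbb C^n$, where $e_1,\dots,e_n$ is the standard basis. For $i\ge 1$ let $c^i_n$ be the number of partitions $\lambda=(\lambda_1\ge\cdots\ge\lambda_m)$ of $n$ such that the seaweed of type $\frac{\lambda_1|\cdots|\lambda_m}{1|\cdots|1}$ (with $n$ ones below) has index $n-i$. Then for each fixed $i\ge 1$ the sequence $(c^i_n)_{n\ge 1}$ is eventually constant; more precisely, there is a number $c^i$ with $c^i_n=c^i$ for all $n\ge\max(1,3i-3)$. Moreover,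 as formal power series, $$\sum_{i\ge 1}c^i x^{i-1}=\prod_{m\ge 1}\frac{1}{(1-x^m)^2},$$ and $c^i$ is the number of partitions of $i-1$ into parts of two kinds, that is, of finite multisets of positive integers, each coloured in one of two colours, with sum $i-1$. -/

import Mathlib

open scoped PowerSeries.WithPiTopology

noncomputable section

namespace Seaweed

attribute [local instance 100] LieRing.ofAssociativeRing

/-- The Kirillov form `B_f(x, y) = f([x, y])` of a linear form `f` on a Lie algebra. -/
def kirillovForm {K L : Type*} [Field K] [LieRing L] [LieAlgebra K L] (f : Module.Dual K L) :
    L →ₗ[K] L →ₗ[K] K :=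
  LinearMap.mk₂ K (fun x y => f ⁅x, y⁆)
    (fun x y z => by simp) (fun c x y => by simp) (fun x y z => by simp) (fun c x y => by simp)

/-- The index of a (finite-dimensional) Lie algebra: the minimum over all linear forms `f` of the
dimension of the kernel of the Kirillov form of `f`. -/
def lieIndex (K L : Type*) [Field K] [LieRing L] [LieAlgebra K L] : ℕ :=
  ⨅ f : Module.Dual K L, Module.finrank K (LinearMap.ker (kirillovForm f))

/-- `V_i = span {e_1, …, e_{a_1 + ⋯ + a_i}}` in `ℂⁿ`. The basis is indexed by `Fin n`, from `0`. -/
def topFlag {n : ℕ} (a : Composition n) (i : ℕ) : Submodule ℂ (Fin n → ℂ) :=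
  Submodule.span ℂ {v | ∃ k : Fin n, (k : ℕ) < a.sizeUpTo i ∧ v = Pi.single k 1}

/-- `W_j = span {e_{b_1 + ⋯ + b_j + 1}, …, e_n}` in `ℂⁿ`. The basis is indexed by `Fin n`,
from `0`. -/
def bottomFlag {n : ℕ} (b : Composition n) (j : ℕ) : Submodule ℂ (Fin n → ℂ) :=
  Submodule.span ℂ {v | ∃ k : Fin n, b.sizeUpTo j ≤ (k : ℕ) ∧ v = Pi.single k 1}

/-- The seaweed of type `a_1|⋯|a_m / b_1|⋯|b_t`: the Lie algebra of trace-zero matrices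
preserving both flags. -/
def seaweed {n : ℕ} (a b : Composition n) : LieSubalgebra ℂ (Matrix (Fin n) (Fin n) ℂ) where
  carrier := {A | A ∈ LieAlgebra.SpecialLinear.sl (Fin n) ℂ ∧
    (∀ i ≤ a.length, ∀ v ∈ topFlag a i, A.mulVec v ∈ topFlag a i) ∧
    (∀ j ≤ b.length, ∀ v ∈ bottomFlag b j, A.mulVec v ∈ bottomFlag b j)}
  zero_mem' := by
    refine ⟨zero_mem _, fun i _ v _ => ?_, fun j _ v _ => ?_⟩ <;>
      simp only [Matrix.zero_mulVec, Submodule.zero_mem]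
  add_mem' := by
    rintro A B ⟨hA, hA₁, hA₂⟩ ⟨hB, hB₁, hB₂⟩
    refine ⟨add_mem hA hB, fun i hi v hv => ?_, fun j hj v hv => ?_⟩ <;> rw [Matrix.add_mulVec]
    · exact add_mem (hA₁ i hi v hv) (hB₁ i hi v hv)
    · exact add_mem (hA₂ j hj v hv) (hB₂ j hj v hv)
  smul_mem' := by
    rintro c A ⟨hA, hA₁, hA₂⟩
    refine ⟨(LieAlgebra.SpecialLinear.sl (Fin n) ℂ).smul_mem c hA, fun i hi v hv => ?_,
      fun j hj v hv => ?_⟩ <;> rw [Matrix.smul_mulVec]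
    · exact Submodule.smul_mem _ c (hA₁ i hi v hv)
    · exact Submodule.smul_mem _ c (hA₂ j hj v hv)
  lie_mem' := by
    rintro A B ⟨hA, hA₁, hA₂⟩ ⟨hB, hB₁, hB₂⟩
    refine ⟨LieSubalgebra.lie_mem _ hA hB, fun i hi v hv => ?_, fun j hj v hv => ?_⟩ <;>
      rw [Ring.lie_def, Matrix.sub_mulVec, ← Matrix.mulVec_mulVec, ← Matrix.mulVec_mulVec]
    · exact sub_mem (hA₁ i hi _ (hB₁ i hi v hv)) (hB₁ i hi _ (hA₁ i hi v hv))
    · exact sub_mem (hA₂ j hj _ (hB₂ j hj v hv)) (hB₂ j hj _ (hA₂ j hj v hv))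

/-- A partition `λ_1 ≥ ⋯ ≥ λ_m` of `n`, read as the composition `λ_1|⋯|λ_m`. -/
def toComposition {n : ℕ} (p : n.Partition) : Composition n where
  blocks := p.parts.sort (· ≥ ·)
  blocks_pos := fun h => p.parts_pos ((Multiset.mem_sort _).1 h)
  blocks_sum := by
    rw [← Multiset.sum_coe, Multiset.sort_eq, p.parts_sum]

/-- The index of the seaweed `λ_1|⋯|λ_m / 1|⋯|1`. -/
def onesIndex {n : ℕ} (p : n.Partition) : ℕ :=
  lieIndex ℂ (seaweed (toComposition p) (Composition.ones n))

/-- `c^i_n`: the number of partitions `λ` of `n` whose seaweed `λ_1|⋯|λ_m / 1|⋯|1` has index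
`n - i` (an equation between integers). -/
def onesCount (i n : ℕ) : ℕ :=
  (Finset.univ.filter fun p : n.Partition => (onesIndex p : ℤ) = (n : ℤ) - (i : ℤ)).card

/-- The partitions of `k` into parts of two kinds: finite multisets of coloured positive integers
whose sizes add up to `k`. -/
def twoKindPartitions (k : ℕ) : Set (Multiset (ℕ × Bool)) :=
  {s | (∀ x ∈ s, 0 < x.1) ∧ (s.map Prod.fst).sum = k}

end Seaweed

end

noncomputable section

namespace Seaweed

attribute [local instance 100] LieRing.ofAssociativeRing

/-! ### Counting partitions into parts of two kinds -/

/-! The ones below force lower triangularity and the flag of `λ` then forces block diagonality, so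
the seaweed consists of the trace-zero block diagonal matrices with lower triangular blocks of sizes
`λ_j`. The theorem follows from the index formula `ind = n - 1 - ∑ ⌊λ_j / 2⌋`
(`onesIndex_add_one_add`).

Cut each block into a first and a second half, a middle position going to the second, and let `s = n
- ∑ ⌊λ_j / 2⌋` be the number of second-half positions. The corner, from first-half columns to
second-half rows, is an abelian ideal, and the full triangular algebra has dimension `2 dim(corner)
+ s` (`card_lower`).

Lower bound: the restriction of any form to the corner is brought to monomial shape by the Levi
part, and a torus of dimension at least `s` fixes it. Corner plus torus is isotropic for the
Kirillov form (`exists_isotropic`); passing to trace zero, the dimension inequality for isotropic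
subspaces gives a kernel of dimension at least `s - 1`. Upper bound: the sum of the antidiagonal
corner entries is a form whose kernel consists of reflection-invariant diagonal matrices of trace
zero, which have dimension at most `s - 1`.

Hence the index is `n - i` exactly when `∑ ⌊λ_j / 2⌋ = i - 1`. Ones contribute nothing, and a part
`2m` or `2m + 1` with `m ≥ 1` is a part `m` in one of two colours. A coloured partition of `k` uses
parts of total at most `3k`, so it can be filled up with ones once `n ≥ 3k`; with `k = i - 1` this
is the bound `3i - 3`. -/

theorem hasProd_partition_sq :
    HasProd (fun m : ℕ => ((1 - (PowerSeries.X : PowerSeries ℚ) ^ (m + 1)) ^ 2)⁻¹)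
      ((PowerSeries.mk fun k : ℕ => (Fintype.card k.Partition : ℚ)) ^ 2) := by
  have h := Nat.Partition.hasProd_powerSeriesMk_card_restricted ℚ (fun _ => True)
  have e : ∀ m : ℕ, (∑' j : ℕ, (PowerSeries.X : PowerSeries ℚ) ^ ((m + 1) * j)) =
      (1 - (PowerSeries.X : PowerSeries ℚ) ^ (m + 1))⁻¹ := by
    intro m
    rw [PowerSeries.eq_inv_iff_mul_eq_one (by simp)]
    simp_rw [pow_mul]
    exact PowerSeries.WithPiTopology.tsum_pow_mul_one_sub_of_constantCoeff_eq_zero (by simp)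
  have h2 := h.mul h
  simp only [Nat.Partition.restricted, if_true, e, implies_true, Finset.filter_true,
    Finset.card_univ] at h2
  rw [pow_two]
  refine h2.congr_fun fun m => ?_
  rw [pow_two, PowerSeries.mul_inv_rev]

/-- Splitting a coloured partition into its two colour classes. -/
theorem ncard_twoKindPartitions (k : ℕ) :
    (twoKindPartitions k).ncard =
      ∑ x ∈ Finset.HasAntidiagonal.antidiagonal k,
        Fintype.card x.1.Partition * Fintype.card x.2.Partition := by
  have h : ∑ x ∈ Finset.HasAntidiagonal.antidiagonal k,
        Fintype.card x.1.Partition * Fintype.card x.2.Partition =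
      ((Finset.HasAntidiagonal.antidiagonal k).sigma
        fun x => (Finset.univ : Finset (x.1.Partition × x.2.Partition))).card := by
    simp [Finset.card_sigma]
  rw [h, ← Set.ncard_coe_finset]
  have key : ∀ (a b : Multiset ℕ) (c : Bool),
      ((a.map (fun m => (m, false)) + b.map (fun m => (m, true))).filter (·.2 = c)).map Prod.fst =
        bif c then b else a := by
    intro a b c
    cases c <;> simp [Multiset.filter_map]
  symm
  refine Set.ncard_congr (fun y _ => y.2.1.parts.map (fun m => (m, false)) +
    y.2.2.parts.map (fun m => (m, true))) ?_ ?_ ?_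
  · rintro ⟨x, p, q⟩ hx
    simp only [Finset.coe_sigma, Set.mem_sigma_iff, Finset.mem_coe,
      Finset.HasAntidiagonal.mem_antidiagonal] at hx
    refine ⟨?_, ?_⟩
    · intro z hz
      simp only [Multiset.mem_add, Multiset.mem_map] at hz
      rcases hz with ⟨m, hm, rfl⟩ | ⟨m, hm, rfl⟩
      · exact p.parts_pos hm
      · exact q.parts_pos hm
    · simp [Multiset.map_map, p.parts_sum, q.parts_sum, hx.1]
  · rintro ⟨⟨x, x'⟩, p, q⟩ ⟨⟨y, y'⟩, p', q'⟩ _ _ he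
    have h1 := congrArg (fun s => (s.filter (·.2 = false)).map Prod.fst) he
    have h2 := congrArg (fun s => (s.filter (·.2 = true)).map Prod.fst) he
    simp only [key, cond_false, cond_true] at h1 h2
    obtain rfl : x = y :=
      p.parts_sum.symm.trans ((congrArg _ h1).trans p'.parts_sum)
    obtain rfl : x' = y' :=
      q.parts_sum.symm.trans ((congrArg _ h2).trans q'.parts_sum)
    rw [Nat.Partition.ext h1, Nat.Partition.ext h2]
  · rintro s ⟨hs, hk⟩
    have hsplit : s.filter (·.2 = false) + s.filter (·.2 = true) = s := by
      have := Multiset.filter_add_not (fun z : ℕ × Bool => z.2 = false) s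
      simpa using this
    have hpos : ∀ c, ∀ {i : ℕ}, i ∈ (s.filter (·.2 = c)).map Prod.fst → 0 < i := by
      intro c i hi
      obtain ⟨z, hz, rfl⟩ := Multiset.mem_map.1 hi
      exact hs z (Multiset.mem_filter.1 hz).1
    have hback : ∀ c, ((s.filter (·.2 = c)).map Prod.fst).map (fun m => (m, c)) =
        s.filter (·.2 = c) := by
      intro c
      rw [Multiset.map_map]
      conv_rhs => rw [← Multiset.map_id (s.filter (·.2 = c))]
      refine Multiset.map_congr rfl fun z hz => ?_
      rw [← (Multiset.mem_filter.1 hz).2]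
      rfl
    refine ⟨⟨(((s.filter (·.2 = false)).map Prod.fst).sum,
      ((s.filter (·.2 = true)).map Prod.fst).sum),
      ⟨_, hpos false, rfl⟩, ⟨_, hpos true, rfl⟩⟩, ?_, ?_⟩
    · simp only [Finset.coe_sigma, Set.mem_sigma_iff, Finset.mem_coe,
        Finset.HasAntidiagonal.mem_antidiagonal, Finset.mem_univ, and_true]
      rw [← Multiset.sum_add, ← Multiset.map_add, hsplit, hk]
    · simp only [hback, hsplit]

theorem powerSeriesMk_ncard_twoKindPartitions :
    (PowerSeries.mk fun k : ℕ => ((twoKindPartitions k).ncard : ℚ)) =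
      (PowerSeries.mk fun k : ℕ => (Fintype.card k.Partition : ℚ)) ^ 2 := by
  ext k
  rw [pow_two, PowerSeries.coeff_mul, PowerSeries.coeff_mk, ncard_twoKindPartitions]
  simp

/-- The part `2 m` or `2 m + 1`, according to the colour of `m`. -/
def partOfKind (x : ℕ × Bool) : ℕ := 2 * x.1 + x.2.toNat

/-- The colouring of a part `x` by its parity, of size `x / 2`. -/
def kindOfPart (x : ℕ) : ℕ × Bool := (x / 2, x.bodd)

theorem partOfKind_kindOfPart (x : ℕ) : partOfKind (kindOfPart x) = x := by
  have := Nat.bodd_add_div2 x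
  rw [Nat.div2_val] at this
  simp only [partOfKind, kindOfPart]
  omega

theorem kindOfPart_partOfKind (x : ℕ × Bool) : kindOfPart (partOfKind x) = x := by
  obtain ⟨m, c⟩ := x
  cases c
  · simp [partOfKind, kindOfPart]
  · simp [partOfKind, kindOfPart]
    omega

/-- The worst ratio of part to size is `3`, attained by the part `3 = 2 * 1 + 1`; this is the source
of the bound `3i - 3`. -/
theorem sum_map_partOfKind_le (s : Multiset (ℕ × Bool)) (hs : ∀ x ∈ s, 0 < x.1) :
    (s.map partOfKind).sum ≤ 3 * (s.map Prod.fst).sum := by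
  rw [← Multiset.sum_map_mul_left]
  refine Multiset.sum_map_le_sum_map _ _ fun x hx => ?_
  have := hs x hx
  have := x.2.toNat_le
  simp only [partOfKind]
  omega

/-- The number of ones is forced by the sum, so the parts greater than `1` determine the partition.
-/
theorem filter_partition_parts {n : ℕ} (p : n.Partition) :
    p.parts.filter (1 < ·) + Multiset.replicate (n - (p.parts.filter (1 < ·)).sum) 1 =
      p.parts := by
  have h := Multiset.filter_add_not (1 < ·) p.parts
  have h1 : p.parts.filter (¬ 1 < ·) =
      Multiset.replicate (p.parts.filter (¬ 1 < ·)).card 1 := by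
    refine Multiset.eq_replicate_card.2 fun b hb => ?_
    obtain ⟨hb, hb'⟩ := Multiset.mem_filter.1 hb
    have := p.parts_pos hb
    omega
  have h2 := congrArg Multiset.sum h
  rw [h1, Multiset.sum_add, p.parts_sum, Multiset.sum_replicate, smul_eq_mul, mul_one] at h2
  have h3 : n - (p.parts.filter (1 < ·)).sum = (p.parts.filter (¬ 1 < ·)).card := by omega
  rw [h3, ← h1, h]

theorem card_filter_sum_half (n k : ℕ) (h : 3 * k ≤ n) :
    (Finset.univ.filter fun p : n.Partition => (p.parts.map (· / 2)).sum = k).card =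
      (twoKindPartitions k).ncard := by
  rw [← Set.ncard_coe_finset]
  refine Set.ncard_congr (fun p _ => (p.parts.filter (1 < ·)).map kindOfPart) ?_ ?_ ?_
  · intro p hp
    simp only [Finset.coe_filter, Finset.mem_univ, true_and, Set.mem_ofPred_eq] at hp
    refine ⟨?_, ?_⟩
    · intro x hx
      obtain ⟨m, hm, rfl⟩ := Multiset.mem_map.1 hx
      have := (Multiset.mem_filter.1 hm).2
      simp only [kindOfPart]
      omega
    · rw [← filter_partition_parts p] at hp
      simpa [Multiset.map_map, Function.comp_def, kindOfPart] using hp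
  · intro p q _ _ he
    have he' := congrArg (Multiset.map partOfKind) he
    simp only [Multiset.map_map, Function.comp_def, partOfKind_kindOfPart, Multiset.map_id'] at he'
    apply Nat.Partition.ext
    rw [← filter_partition_parts p, ← filter_partition_parts q, he']
  · rintro s ⟨hs, hk⟩
    -- With `3 * k ≤ n` this leaves room for a nonnegative number of ones, so the truncated
    -- subtraction below is exact.
    have hle := sum_map_partOfKind_le s hs
    have hf : (s.map partOfKind + Multiset.replicate (n - (s.map partOfKind).sum) 1).filter
        (1 < ·) = s.map partOfKind := by
      rw [Multiset.filter_add, Multiset.filter_eq_self.2, Multiset.filter_eq_nil.2, add_zero]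
      · intro a ha
        simp [Multiset.eq_of_mem_replicate ha]
      · intro a ha
        obtain ⟨x, hx, rfl⟩ := Multiset.mem_map.1 ha
        have := hs x hx
        simp only [partOfKind]
        omega
    refine ⟨⟨s.map partOfKind + Multiset.replicate (n - (s.map partOfKind).sum) 1, ?_, ?_⟩, ?_, ?_⟩
    · intro i hi
      rcases Multiset.mem_add.1 hi with hi | hi
      · obtain ⟨x, hx, rfl⟩ := Multiset.mem_map.1 hi
        have := hs x hx
        simp only [partOfKind]
        omega
      · simp [Multiset.eq_of_mem_replicate hi]
    · simp only [Multiset.sum_add, Multiset.sum_replicate, smul_eq_mul, mul_one]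
      omega
    · have : ∀ x : ℕ × Bool, partOfKind x / 2 = x.1 := fun x =>
        congrArg Prod.fst (kindOfPart_partOfKind x)
      simp [Multiset.map_map, this, hk]
    · simp only [hf]
      simp [Multiset.map_map, kindOfPart_partOfKind]

/-! ### Isotropic subspaces -/

/-- By isotropy `B ∘ j` sends `U` into the annihilator of `j U`, of dimension `dim V - dim U`, and
its kernel embeds in `ker B`. Rank-nullity gives the inequality. -/
theorem two_mul_finrank_le_of_isotropic {K U V : Type*} [Field K] [AddCommGroup U] [Module K U]
    [AddCommGroup V] [Module K V] [FiniteDimensional K V] (B : V →ₗ[K] V →ₗ[K] K)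
    (j : U →ₗ[K] V) (hj : Function.Injective j) (hB : ∀ u u', B (j u) (j u') = 0) :
    2 * Module.finrank K U ≤ Module.finrank K V + Module.finrank K (LinearMap.ker B) := by
  have : FiniteDimensional K U := Module.Finite.of_injective j hj
  have h1 := LinearMap.finrank_range_add_finrank_ker (B ∘ₗ j)
  have h2 := Subspace.finrank_add_finrank_dualAnnihilator_eq (LinearMap.range j)
  rw [LinearMap.finrank_range_of_inj hj] at h2
  have h3 : Module.finrank K (LinearMap.range (B ∘ₗ j)) ≤
      Module.finrank K (LinearMap.range j).dualAnnihilator := by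
    refine Submodule.finrank_mono ?_
    rintro _ ⟨u, rfl⟩
    rw [Submodule.mem_dualAnnihilator]
    rintro _ ⟨u', rfl⟩
    exact hB u u'
  have h4 : Module.finrank K (LinearMap.ker (B ∘ₗ j)) ≤ Module.finrank K (LinearMap.ker B) := by
    refine LinearMap.finrank_le_finrank_of_injective
      (f := j.restrict (p := LinearMap.ker (B ∘ₗ j)) (q := LinearMap.ker B) fun u hu => hu) ?_
    intro a b hab
    exact Subtype.ext (hj (congrArg Subtype.val hab))
  omega

/-! ### Matrices supported on a relation -/

section Supported

variable {ι K : Type*} [Field K]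

/-- The matrices whose nonzero entries lie at positions satisfying `R`. -/
def supported (K : Type*) [Field K] (R : ι → ι → Prop) : Submodule K (Matrix ι ι K) where
  carrier := {X | ∀ p q, X p q ≠ 0 → R p q}
  zero_mem' := fun p q h => absurd rfl h
  add_mem' := by
    intro X Y hX hY p q h
    by_contra hR
    exact h (by rw [Matrix.add_apply, not_not.1 (mt (hX p q) hR), not_not.1 (mt (hY p q) hR),
      add_zero])
  smul_mem' := by
    intro c X hX p q h
    by_contra hR
    exact h (by rw [Matrix.smul_apply, not_not.1 (mt (hX p q) hR), smul_zero])

theorem mem_supported {R : ι → ι → Prop} {X : Matrix ι ι K} :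
    X ∈ supported K R ↔ ∀ p q, X p q ≠ 0 → R p q := Iff.rfl

theorem apply_eq_zero_of_mem_supported {R : ι → ι → Prop} {X : Matrix ι ι K}
    (hX : X ∈ supported K R) {p q : ι} (h : ¬ R p q) : X p q = 0 :=
  not_not.1 (mt (hX p q) h)

theorem supported_mono {R S : ι → ι → Prop} (h : ∀ p q, R p q → S p q) :
    supported K R ≤ supported K S := fun _ hX p q hpq => h p q (hX p q hpq)

theorem mul_mem_supported [Fintype ι] {R S T : ι → ι → Prop} {X Y : Matrix ι ι K}
    (hX : X ∈ supported K R) (hY : Y ∈ supported K S) (h : ∀ p q r, R p q → S q r → T p r) :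
    X * Y ∈ supported K T := by
  intro p r hpr
  rw [Matrix.mul_apply] at hpr
  obtain ⟨q, -, hq⟩ := Finset.exists_ne_zero_of_sum_ne_zero hpr
  exact h p q r (hX p q (left_ne_zero_of_mul hq)) (hY q r (right_ne_zero_of_mul hq))

theorem mul_eq_zero_of_mem_supported [Fintype ι] {R S : ι → ι → Prop} {X Y : Matrix ι ι K}
    (hX : X ∈ supported K R) (hY : Y ∈ supported K S) (h : ∀ p q r, R p q → ¬ S q r) :
    X * Y = 0 := by
  -- No index path is compatible with both supports, so the product is supported on the empty
  -- relation.
  have := mul_mem_supported (T := fun _ _ => False) hX hY fun p q r h1 h2 => h p q r h1 h2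
  ext p q
  exact apply_eq_zero_of_mem_supported this not_false

theorem diagonal_mem_supported [DecidableEq ι] {R : ι → ι → Prop} (h : ∀ p, R p p) (d : ι → K) :
    Matrix.diagonal d ∈ supported K R := by
  intro p q hpq
  obtain rfl : p = q := by
    by_contra hne
    exact hpq (Matrix.diagonal_apply_ne d hne)
  exact h p

theorem one_mem_supported [DecidableEq ι] {R : ι → ι → Prop} (h : ∀ p, R p p) :
    (1 : Matrix ι ι K) ∈ supported K R := by
  rw [← Matrix.diagonal_one]
  exact diagonal_mem_supported h _

theorem single_mem_supported [DecidableEq ι] {R : ι → ι → Prop} {p q : ι} (h : R p q) (c : K) :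
    Matrix.single p q c ∈ supported K R := by
  intro p' q' hpq
  by_contra hR
  refine hpq (Matrix.single_apply_of_ne _ _ _ _ _ ?_)
  rintro ⟨rfl, rfl⟩
  exact hR h

/-- A matrix supported on `R` is determined by its entries at the positions of `R`. -/
def supportedEquiv (R : ι → ι → Prop) [DecidableRel R] :
    supported K R ≃ₗ[K] ({x : ι × ι // R x.1 x.2} → K) where
  toFun X x := X.1 x.1.1 x.1.2
  map_add' _ _ := rfl
  map_smul' _ _ := rfl
  invFun v := ⟨Matrix.of fun p q => if h : R p q then v ⟨(p, q), h⟩ else 0, fun p q hpq => by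
    by_contra h
    exact hpq (by simp [h])⟩
  left_inv X := by
    ext p q
    by_cases h : R p q
    · simp [h]
    · simp [h, apply_eq_zero_of_mem_supported X.2 h]
  right_inv v := by
    ext ⟨⟨p, q⟩, h⟩
    have h' : R p q := h
    simp [h']

theorem finrank_supported [Fintype ι] (R : ι → ι → Prop) [DecidableRel R] :
    Module.finrank K (supported K R) =
      (Finset.univ.filter fun x : ι × ι => R x.1 x.2).card := by
  rw [(supportedEquiv R).finrank_eq, Module.finrank_fintype_fun_eq_card, Fintype.card_subtype]

end Supported

/-! ### Block reversals -/

/-- A decomposition of a linear order into blocks, with an order-reversing involution of every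
block. -/
structure BlockReversal (ι : Type*) [LinearOrder ι] where
  /-- The block of an element. -/
  block : ι → ℕ
  /-- The involution. -/
  rev : ι → ι
  rev_rev : ∀ a, rev (rev a) = a
  block_rev : ∀ a, block (rev a) = block a
  rev_le_rev : ∀ a b, block a = block b → a ≤ b → rev b ≤ rev a

namespace BlockReversal

variable {ι : Type*} [LinearOrder ι] (β : BlockReversal ι)

/-- The relation of the block diagonal matrices with lower triangular blocks. -/
def Lower (p q : ι) : Prop := β.block p = β.block q ∧ q ≤ p

/-- `p` lies in the first half of its block. -/
def First (p : ι) : Prop := p < β.rev p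

/-- The positions within a block from the second half to the first half. -/
def Corner (p q : ι) : Prop := β.block p = β.block q ∧ ¬ β.First p ∧ β.First q

/-- The positions of `Lower` inside one half of a block. -/
def Levi (p q : ι) : Prop := β.Lower p q ∧ (β.First p ↔ β.First q)

instance : DecidablePred β.First := fun _ => inferInstanceAs (Decidable (_ < _))
instance : DecidableRel β.Lower := fun _ _ => inferInstanceAs (Decidable (_ ∧ _))
instance : DecidableRel β.Corner := fun _ _ => inferInstanceAs (Decidable (_ ∧ _))

theorem Levi.trans {p q r : ι} (h : β.Levi p q) (h' : β.Levi q r) : β.Levi p r :=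
  ⟨⟨h.1.1.trans h'.1.1, h'.1.2.trans h.1.2⟩, h.2.trans h'.2⟩

theorem levi_refl (p : ι) : β.Levi p p := ⟨⟨rfl, le_rfl⟩, Iff.rfl⟩

theorem rev_lt_rev {a b : ι} (h : β.block a = β.block b) (hab : a < b) : β.rev b < β.rev a := by
  refine lt_of_le_of_ne (β.rev_le_rev a b h hab.le) fun he => hab.ne ?_
  rw [← β.rev_rev a, ← β.rev_rev b, he]

theorem lt_of_corner {p q : ι} (h : β.Corner p q) : q < p := by
  obtain ⟨hb, h2, h1⟩ := h
  by_contra hle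
  have h3 := β.rev_le_rev p q hb (not_lt.1 hle)
  simp only [First, not_lt] at h1 h2
  exact absurd (h1.trans_le (h3.trans (h2.trans (not_lt.1 hle)))) (lt_irrefl _)

theorem lower_of_corner {p q : ι} (h : β.Corner p q) : β.Lower p q := ⟨h.1, (β.lt_of_corner h).le⟩

/-- The dimension count: `dim b = 2 dim (corner) + #(second half)`. -/
theorem card_lower [Fintype ι] :
    (Finset.univ.filter fun x : ι × ι => β.Lower x.1 x.2).card =
      2 * (Finset.univ.filter fun x : ι × ι => β.Corner x.1 x.2).card +
        (Finset.univ.filter fun p : ι => ¬ β.First p).card := by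
  classical
  set L := Finset.univ.filter fun x : ι × ι => β.Lower x.1 x.2 with hL
  set C := Finset.univ.filter fun x : ι × ι => β.Corner x.1 x.2 with hC
  have mL : ∀ x, x ∈ L ↔ β.block x.1 = β.block x.2 ∧ x.2 ≤ x.1 := fun x => by
    rw [hL, Finset.mem_filter]
    simp [Lower]
  have mC : ∀ x, x ∈ C ↔ β.block x.1 = β.block x.2 ∧ ¬ x.1 < β.rev x.1 ∧ x.2 < β.rev x.2 :=
    fun x => by
      rw [hC, Finset.mem_filter]
      simp [Corner, First]
  have e1 : L.filter (fun x => β.Corner x.1 x.2) = C := by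
    ext x
    simp only [hL, hC, Finset.mem_filter, Finset.mem_univ, true_and]
    exact ⟨fun h => h.2, fun h => ⟨β.lower_of_corner h, h⟩⟩
  clear_value L C
  -- Outside the corner lie two triangles. Reflecting one index carries the first-half triangle onto
  -- the corner cells with `rev row ≤ column` and the strict second-half triangle (`e4`) onto the
  -- remaining corner cells; only the second-half diagonal (`e3`) is left over.
  have e2 : ((L.filter fun x => ¬ β.Corner x.1 x.2).filter fun x => β.First x.1).card =
      (C.filter fun x => β.rev x.1 ≤ x.2).card := by
    refine Finset.card_nbij' (fun x => (β.rev x.2, x.1)) (fun x => (x.2, β.rev x.1)) ?_ ?_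
      (fun x _ => by simp [β.rev_rev]) (fun x _ => by simp [β.rev_rev])
    · intro x hx
      have h3 := β.rev_le_rev x.2 x.1
      simp only [Finset.mem_coe, Finset.mem_filter, mL, mC] at hx ⊢
      simp only [Corner, First, β.rev_rev, β.block_rev] at hx ⊢
      grind
    · intro x hx
      simp only [Finset.mem_coe, Finset.mem_filter, mL, mC] at hx ⊢
      simp only [Corner, First, β.rev_rev, β.block_rev] at hx ⊢
      grind
  have e3 : (((L.filter fun x => ¬ β.Corner x.1 x.2).filter fun x => ¬ β.First x.1).filter
      fun x => x.1 = x.2).card = (Finset.univ.filter fun p : ι => ¬ β.First p).card := by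
    refine Finset.card_nbij' (fun x => x.1) (fun p => (p, p)) ?_ ?_ ?_ (fun _ _ => rfl)
    · intro x hx
      simp only [Finset.coe_filter, Finset.mem_filter, Finset.mem_univ, true_and,
        Set.mem_ofPred_eq] at hx ⊢
      exact hx.1.2
    · intro p hp
      simp only [Finset.mem_coe, Finset.mem_filter, Finset.mem_univ, true_and, mL] at hp ⊢
      simp only [Corner]
      grind
    · intro x hx
      simp only [Finset.coe_filter, Set.mem_ofPred_eq] at hx
      exact Prod.ext rfl hx.2
  have e4 : (((L.filter fun x => ¬ β.Corner x.1 x.2).filter fun x => ¬ β.First x.1).filter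
      fun x => ¬ x.1 = x.2).card = (C.filter fun x => ¬ β.rev x.1 ≤ x.2).card := by
    refine Finset.card_nbij' (fun x => (x.2, β.rev x.1)) (fun x => (β.rev x.2, x.1)) ?_ ?_
      (fun x _ => by simp [β.rev_rev]) (fun x _ => by simp [β.rev_rev])
    · intro x hx
      have h3 := β.rev_lt_rev (a := x.2) (b := x.1)
      simp only [Finset.mem_coe, Finset.mem_filter, mL, mC] at hx ⊢
      simp only [Corner, First, β.rev_rev, β.block_rev] at hx ⊢
      grind
    · intro x hx
      have h3 := β.rev_lt_rev (a := x.2) (b := β.rev x.1)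
      simp only [Finset.mem_coe, Finset.mem_filter, mL, mC] at hx ⊢
      simp only [Corner, First, β.rev_rev, β.block_rev] at hx h3 ⊢
      grind
  have s1 := Finset.card_filter_add_card_filter_not (s := L) (fun x => β.Corner x.1 x.2)
  have s2 := Finset.card_filter_add_card_filter_not (s := L.filter fun x => ¬ β.Corner x.1 x.2)
    (fun x => β.First x.1)
  have s3 := Finset.card_filter_add_card_filter_not
    (s := (L.filter fun x => ¬ β.Corner x.1 x.2).filter fun x => ¬ β.First x.1)
    (fun x => x.1 = x.2)
  have s4 := Finset.card_filter_add_card_filter_not (s := C) (fun x => β.rev x.1 ≤ x.2)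
  rw [e1] at s1
  omega

end BlockReversal

namespace BlockReversal

/-! ### Reduction to monomial form -/

section Elimination

variable {n : ℕ} {K : Type*} [Field K]

/-- In each of the first `k` rows, every nonzero entry is alone in its row and column. -/
def MonomialUpTo (k : ℕ) (F : Matrix (Fin n) (Fin n) K) : Prop :=
  ∀ p q : Fin n, (p : ℕ) < k → F p q ≠ 0 →
    (∀ q', F p q' ≠ 0 → q' = q) ∧ ∀ p', F p' q ≠ 0 → p' = p

/-- The two-sided elimination of the row and the column of a pivot `(r, q)`, as one conjugation. -/
theorem exists_conj_pivot (F : Matrix (Fin n) (Fin n) K) {r q : Fin n} (hrq : F r q ≠ 0)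
    (P : Fin n → Prop) (hF : ∀ i j, F i j ≠ 0 → P i ∧ ¬ P j) (S : Fin n → Fin n → Prop)
    (hS : ∀ i, S i i) (hrow : ∀ i, i ≠ r → F i q ≠ 0 → S i r)
    (hcol : ∀ j, j ≠ q → F r j ≠ 0 → S q j) :
    ∃ g g' : Matrix (Fin n) (Fin n) K, g ∈ supported K S ∧ g' ∈ supported K S ∧
      g * g' = 1 ∧ g' * g = 1 ∧
      ∀ i j, (g * F * g') i j =
        if i = r then (if j = q then F r q else 0) else F i j - F i q * F r j / F r q := by
  set a : Fin n → K := fun i => if i = r then 0 else F i q / F r q with ha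
  set b : Fin n → K := fun j => if j = q then 0 else F r j / F r q with hb
  have hPa : ∀ i, a i ≠ 0 → P i ∧ i ≠ r ∧ F i q ≠ 0 := by
    intro i hi
    by_cases h : i = r
    · simp [ha, h] at hi
    · have : F i q ≠ 0 := fun h0 => hi (by simp [ha, h0])
      exact ⟨(hF i q this).1, h, this⟩
  have hPb : ∀ j, b j ≠ 0 → ¬ P j ∧ j ≠ q ∧ F r j ≠ 0 := by
    intro j hj
    by_cases h : j = q
    · simp [hb, h] at hj
    · have : F r j ≠ 0 := fun h0 => hj (by simp [hb, h0])
      exact ⟨(hF r j this).2, h, this⟩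
  have har : a r = 0 := by simp [ha]
  have hbq : b q = 0 := by simp [hb]
  have hrq' : r ≠ q := by
    rintro rfl
    exact (hF _ _ hrq).2 (hF _ _ hrq).1
  -- `E` encodes the row operations and `C` the column operations. As `F` has its rows in `P` and
  -- its columns outside, all products of `E` and `C` vanish, and so do `C * F` and `F * E`. Thus `1
  -- - E + C` has inverse `1 + E - C`, and conjugation by it clears row and column without
  -- interference.
  set E := Matrix.vecMulVec a (Pi.single r (1 : K)) with hE
  set C := Matrix.vecMulVec (Pi.single q (1 : K)) b with hC
  have hba : b ⬝ᵥ a = 0 := by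
    refine Finset.sum_eq_zero fun i _ => ?_
    by_contra h
    exact (hPb i (left_ne_zero_of_mul h)).1 (hPa i (right_ne_zero_of_mul h)).1
  have hEE : E * E = 0 := by simp [hE, Matrix.vecMulVec_mul_vecMulVec, har]
  have hCC : C * C = 0 := by simp [hC, Matrix.vecMulVec_mul_vecMulVec, hbq]
  have hEC : E * C = 0 := by simp [hE, hC, Matrix.vecMulVec_mul_vecMulVec, hrq']
  have hCE : C * E = 0 := by simp [hE, hC, Matrix.vecMulVec_mul_vecMulVec, hba]
  have hCF : C * F = 0 := by
    have : Matrix.vecMul b F = 0 := by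
      ext j
      rw [Matrix.vecMul, dotProduct, Pi.zero_apply]
      refine Finset.sum_eq_zero fun i _ => ?_
      by_contra h
      exact (hPb i (left_ne_zero_of_mul h)).1 (hF i j (right_ne_zero_of_mul h)).1
    simp [hC, Matrix.vecMulVec_mul, this]
  have hFE : F * E = 0 := by
    have : Matrix.mulVec F a = 0 := by
      ext j
      rw [Matrix.mulVec, dotProduct, Pi.zero_apply]
      refine Finset.sum_eq_zero fun i _ => ?_
      by_contra h
      exact (hF j i (left_ne_zero_of_mul h)).2 (hPa i (right_ne_zero_of_mul h)).1
    simp [hE, Matrix.mul_vecMulVec, this]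
  have hEF : ∀ i j, (E * F) i j = a i * F r j := by
    intro i j
    simp [hE, Matrix.vecMulVec_mul, Matrix.vecMulVec_apply]
  have hFC : ∀ i j, (F * C) i j = F i q * b j := by
    intro i j
    simp [hC, Matrix.mul_vecMulVec, Matrix.vecMulVec_apply]
  have hEFC : ∀ i j, (E * F * C) i j = a i * F r q * b j := by
    intro i j
    simp [hC, Matrix.mul_vecMulVec, Matrix.vecMulVec_apply, hEF]
  have hES : E ∈ supported K S := by
    intro i j hij
    rw [hE, Matrix.vecMulVec_apply] at hij
    have h1 := hPa i (left_ne_zero_of_mul hij)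
    obtain rfl : j = r := by
      by_contra h
      exact right_ne_zero_of_mul hij (Pi.single_eq_of_ne h _)
    exact hrow i h1.2.1 h1.2.2
  have hCS : C ∈ supported K S := by
    intro i j hij
    rw [hC, Matrix.vecMulVec_apply] at hij
    have h1 := hPb j (right_ne_zero_of_mul hij)
    obtain rfl : i = q := by
      by_contra h
      exact left_ne_zero_of_mul hij (Pi.single_eq_of_ne h _)
    exact hcol j h1.2.1 h1.2.2
  have h1S := one_mem_supported (K := K) hS
  refine ⟨1 - E + C, 1 + E - C, add_mem (sub_mem h1S hES) hCS, sub_mem (add_mem h1S hES) hCS,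
    ?_, ?_, ?_⟩
  · simp only [mul_add, add_mul, mul_sub, sub_mul, one_mul, mul_one, hEE, hCC, hEC, hCE]
    abel
  · simp only [mul_add, add_mul, mul_sub, sub_mul, one_mul, mul_one, hEE, hCC, hEC, hCE]
    abel
  · have hg : (1 - E + C) * F * (1 + E - C) = F - E * F - F * C + E * F * C := by
      have h1 : (1 - E + C) * F = F - E * F := by
        rw [add_mul, sub_mul, one_mul, hCF, add_zero]
      rw [h1, mul_sub, mul_add, mul_one, sub_mul, sub_mul, mul_assoc E F E, hFE, mul_zero]
      abel
    intro i j
    rw [hg]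
    simp only [Matrix.add_apply, Matrix.sub_apply, hEF, hFC, hEFC]
    by_cases hi : i = r <;> by_cases hj : j = q
    · subst hi hj
      simp [ha, hb]
    · subst hi
      simp only [ha, hb, hj, if_true, if_false]
      field_simp
      ring
    · subst hj
      simp only [ha, hb, hi, if_true, if_false]
      field_simp
      ring
    · simp only [ha, hb, hi, hj, if_false]
      field_simp
      ring

variable (β : BlockReversal (Fin n))

theorem conj_mem_corner {g g' F : Matrix (Fin n) (Fin n) K} (hg : g ∈ supported K β.Levi)
    (hg' : g' ∈ supported K β.Levi) (hF : F ∈ supported K fun p q => β.Corner q p) :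
    g * F * g' ∈ supported K fun p q => β.Corner q p := by
  refine mul_mem_supported (mul_mem_supported hg hF (T := fun p q => β.Corner q p) ?_) hg' ?_
  · rintro p q r ⟨h1, h2⟩ ⟨h3, h4, h5⟩
    exact ⟨h3.trans h1.1.symm, h4, h2.2 h5⟩
  · rintro p q r ⟨h3, h4, h5⟩ ⟨h1, h2⟩
    exact ⟨h1.1.symm.trans h3, fun h => h4 (h2.2 h), h5⟩

/-- One step of Gaussian elimination in which only operations from the lower triangular Levi part
are allowed; the pivot must be chosen accordingly. -/
theorem exists_conj_monomialUpTo_succ (F : Matrix (Fin n) (Fin n) K)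
    (hF : F ∈ supported K fun p q => β.Corner q p) {k : ℕ} (hk : k < n) (hM : MonomialUpTo k F) :
    ∃ g g' : Matrix (Fin n) (Fin n) K, g ∈ supported K β.Levi ∧ g' ∈ supported K β.Levi ∧
      g * g' = 1 ∧ g' * g = 1 ∧ MonomialUpTo (k + 1) (g * F * g') := by
  have h1 := one_mem_supported (K := K) β.levi_refl
  by_cases h0 : ∀ q, F ⟨k, hk⟩ q = 0
  · refine ⟨1, 1, h1, h1, one_mul _, one_mul _, ?_⟩
    rw [one_mul, mul_one]
    intro p q hp hpq
    have : (p : ℕ) ≠ k := by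
      rintro rfl
      exact hpq (h0 q)
    exact hM p q (by omega) hpq
  · push Not at h0
    classical
    set r : Fin n := ⟨k, hk⟩ with hr
    set s := Finset.univ.filter fun q => F r q ≠ 0 with hs
    have hne : s.Nonempty := by
      obtain ⟨q, hq⟩ := h0
      exact ⟨q, by simp [hs, hq]⟩
    -- The rightmost nonzero entry: column `q` then only has to be subtracted from columns to its
    -- left, which is a lower triangular operation.
    set q := s.max' hne with hq
    have hrq : F r q ≠ 0 := (Finset.mem_filter.1 (s.max'_mem hne)).2
    have hmax : ∀ j, F r j ≠ 0 → j ≤ q := fun j hj => s.le_max' j (by simp [hs, hj])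
    -- A nonzero entry of an earlier row is alone in its column, whereas column `q` contains the
    -- pivot. So only later rows are altered, and earlier rows stay monomial.
    have hlt : ∀ i : Fin n, (i : ℕ) < k → F i q = 0 := by
      intro i hi
      by_contra h
      have := (hM i q hi h).2 r hrq
      rw [← this] at hi
      exact lt_irrefl _ hi
    obtain ⟨g, g', hg, hg', hgg, hgg', hval⟩ := exists_conj_pivot F hrq β.First
      (fun i j h => ⟨(hF i j h).2.2, (hF i j h).2.1⟩) β.Levi β.levi_refl
      (fun i hi h => by
        have hc := hF i q h
        have hc' := hF r q hrq
        refine ⟨⟨hc.1.symm.trans hc'.1, ?_⟩, iff_of_true hc.2.2 hc'.2.2⟩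
        by_contra hlt'
        exact h (hlt i (by simpa [hr, Fin.lt_def] using hlt')))
      (fun j hj h => by
        have hc := hF r j h
        have hc' := hF r q hrq
        exact ⟨⟨hc'.1.trans hc.1.symm, hmax j h⟩, iff_of_false hc'.2.1 hc.2.1⟩)
    refine ⟨g, g', hg, hg', hgg, hgg', ?_⟩
    have hsmall : ∀ i j : Fin n, (i : ℕ) < k → (g * F * g') i j = F i j := by
      intro i j hi
      have : i ≠ r := by
        rintro rfl
        exact lt_irrefl _ hi
      rw [hval, if_neg this, hlt i hi]
      simp
    intro p j hp hpj
    by_cases hpr : p = r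
    · subst hpr
      rw [hval, if_pos rfl] at hpj
      have hj : j = q := by
        by_contra h
        exact hpj (if_neg h)
      subst hj
      refine ⟨fun q' h => ?_, fun p' h => ?_⟩
      · rw [hval, if_pos rfl] at h
        by_contra hne
        exact h (if_neg hne)
      · by_contra hne
        rw [hval, if_neg hne] at h
        exact h (by field_simp; ring)
    · have hp' : (p : ℕ) < k := by
        have : (p : ℕ) ≠ k := fun h => hpr (Fin.ext h)
        omega
      rw [hsmall p j hp'] at hpj
      have hu := hM p j hp' hpj
      have hrj : F r j = 0 := by
        by_contra h
        exact hpr (hu.2 r h).symm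
      refine ⟨fun q' h => hu.1 q' (by rwa [hsmall p q' hp'] at h), fun p' h => ?_⟩
      rw [hval] at h
      by_cases hp'r : p' = r
      · rw [if_pos hp'r] at h
        have hj : j = q := by
          by_contra hh
          exact h (if_neg hh)
        rw [hj] at hrj
        exact absurd hrj hrq
      · rw [if_neg hp'r, hrj] at h
        exact hu.2 p' (by simpa using h)

/-- Every form on the corner is conjugate, under the Levi part, to a monomial one. -/
theorem exists_conj_monomial (F : Matrix (Fin n) (Fin n) K)
    (hF : F ∈ supported K fun p q => β.Corner q p) :
    ∃ g g' : Matrix (Fin n) (Fin n) K, g ∈ supported K β.Levi ∧ g' ∈ supported K β.Levi ∧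
      g * g' = 1 ∧ g' * g = 1 ∧ MonomialUpTo n (g * F * g') := by
  suffices h : ∀ k ≤ n, ∃ g g' : Matrix (Fin n) (Fin n) K, g ∈ supported K β.Levi ∧
      g' ∈ supported K β.Levi ∧ g * g' = 1 ∧ g' * g = 1 ∧ MonomialUpTo k (g * F * g') from
    h n le_rfl
  intro k
  induction k with
  | zero =>
    intro _
    have h1 := one_mem_supported (K := K) β.levi_refl
    exact ⟨1, 1, h1, h1, one_mul _, one_mul _, fun p q hp => absurd hp (Nat.not_lt_zero _)⟩
  | succ k ih =>
    intro hk
    obtain ⟨g, g', hg, hg', h1, h2, hM⟩ := ih (by omega)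
    obtain ⟨u, u', hu, hu', h3, h4, hM'⟩ := β.exists_conj_monomialUpTo_succ (g * F * g')
      (β.conj_mem_corner hg hg' hF) hk hM
    refine ⟨u * g, g' * u', mul_mem_supported hu hg fun _ _ _ => Levi.trans β,
      mul_mem_supported hg' hu' fun _ _ _ => Levi.trans β, ?_, ?_, ?_⟩
    · rw [mul_assoc, ← mul_assoc g, h1, one_mul, h3]
    · rw [mul_assoc, ← mul_assoc u', h4, one_mul, h2]
    · simpa only [mul_assoc] using hM'

end Elimination
end BlockReversal

/-! ### The index of a block diagonal algebra of lower triangular matrices -/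

section Index

variable {n : ℕ} {K : Type*} [Field K]

/-- The trace pairing transposes positions: forms on the corner are represented by matrices
supported on the transposed corner. -/
theorem exists_trace_mul_eq {ι : Type*} [Fintype ι] [DecidableEq ι]
    (L : Submodule K (Matrix ι ι K)) (f : L →ₗ[K] K) :
    ∃ F : Matrix ι ι K, ∀ X : L, f X = (F * X.1).trace := by
  obtain ⟨f', hf'⟩ := LinearMap.exists_extend f
  refine ⟨Matrix.of fun q p => f' (Matrix.single p q 1), fun X => ?_⟩
  rw [← hf', LinearMap.comp_apply, Submodule.subtype_apply]
  conv_lhs => rw [Matrix.matrix_eq_sum_single X.1]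
  simp only [map_sum, Matrix.trace, Matrix.diag, Matrix.mul_apply, Matrix.of_apply]
  rw [Finset.sum_comm]
  refine Finset.sum_congr rfl fun q _ => Finset.sum_congr rfl fun p _ => ?_
  have : Matrix.single p q (X.1 p q) = X.1 p q • Matrix.single p q (1 : K) := by
    rw [Matrix.smul_single, smul_eq_mul, mul_one]
  rw [this, map_smul, smul_eq_mul, mul_comm]

namespace BlockReversal

variable (β : BlockReversal (Fin n))

/-- The diagonal matrices commuting with a matrix that has at most one nonzero entry in every row
and no nonzero entry in the rows outside `P` form a space of codimension at most `#P`. -/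
theorem exists_diagonal_commute (M : Matrix (Fin n) (Fin n) K) (P : Fin n → Prop)
    [DecidablePred P] (hP : ∀ p q, M p q ≠ 0 → P p)
    (hM : ∀ p q, M p q ≠ 0 → ∀ q', M p q' ≠ 0 → q' = q) :
    ∃ T : Submodule K (Fin n → K),
      (Finset.univ.filter fun p => ¬ P p).card ≤ Module.finrank K T ∧
      ∀ d ∈ T, Matrix.diagonal d * M = M * Matrix.diagonal d := by
  -- Each row in `P` imposes one equation: its only possible nonzero entry, in column `q`, demands
  -- `d p = d q`.
  let φ : (Fin n → K) →ₗ[K] ({p // P p} → K) :=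
    LinearMap.pi fun p => ∑ q, M p.1 q • ((LinearMap.proj p.1 : (Fin n → K) →ₗ[K] K) - LinearMap.proj q)
  refine ⟨LinearMap.ker φ, ?_, ?_⟩
  · have h1 := LinearMap.finrank_range_add_finrank_ker φ
    have h2 := Submodule.finrank_le (LinearMap.range φ)
    rw [Module.finrank_fintype_fun_eq_card, Fintype.card_subtype] at h2
    rw [Module.finrank_fintype_fun_eq_card, ← Finset.card_univ] at h1
    have h3 := Finset.card_filter_add_card_filter_not (s := Finset.univ) fun p => P p
    omega
  · intro d hd
    ext p q
    rw [Matrix.diagonal_mul, Matrix.mul_diagonal]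
    by_cases hpq : M p q = 0
    · rw [hpq, mul_zero, zero_mul]
    have h := congrFun (LinearMap.mem_ker.1 hd) ⟨p, hP p q hpq⟩
    simp only [φ, LinearMap.pi_apply, LinearMap.sum_apply, LinearMap.smul_apply,
      LinearMap.sub_apply, LinearMap.proj_apply, Pi.zero_apply, smul_eq_mul] at h
    rw [Finset.sum_eq_single q (fun q' _ hne => ?_) (by simp)] at h
    · rw [(mul_eq_zero.1 h).resolve_left hpq |> sub_eq_zero.1, mul_comm]
    · rw [not_not.1 fun h' => hne (hM p q hpq q' h'), zero_mul]

/-- For every linear form there are, inside the algebra, the abelian corner ideal and a complementary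
torus such that their sum is isotropic. -/
theorem exists_isotropic (F : Matrix (Fin n) (Fin n) K) :
    ∃ (T : Submodule K (Fin n → K)) (g g' : Matrix (Fin n) (Fin n) K),
      (Finset.univ.filter fun p => ¬ β.First p).card ≤ Module.finrank K T ∧
      g ∈ supported K β.Levi ∧ g' ∈ supported K β.Levi ∧ g * g' = 1 ∧
      ∀ a ∈ supported K β.Corner, ∀ a' ∈ supported K β.Corner, ∀ d ∈ T, ∀ d' ∈ T,
        (F * ⁅a + g' * Matrix.diagonal d * g, a' + g' * Matrix.diagonal d' * g⁆).trace = 0 := by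
  classical
  -- The brackets to be tested lie in the corner, so only the entries of `F` paired with the corner
  -- matter.
  let F₀ : Matrix (Fin n) (Fin n) K := Matrix.of fun p q => if β.Corner q p then F p q else 0
  have hF₀ : F₀ ∈ supported K fun p q => β.Corner q p := by
    intro p q h
    by_contra hc
    exact h (by simp [F₀, hc])
  have htr : ∀ Z ∈ supported K β.Corner, (F * Z).trace = (F₀ * Z).trace := by
    intro Z hZ
    simp only [Matrix.trace, Matrix.diag, Matrix.mul_apply]
    refine Finset.sum_congr rfl fun p _ => Finset.sum_congr rfl fun q _ => ?_
    by_cases hc : β.Corner q p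
    · simp [F₀, hc]
    · rw [apply_eq_zero_of_mem_supported hZ hc, mul_zero, mul_zero]
  obtain ⟨g, g', hg, hg', h1, h2, hM⟩ := β.exists_conj_monomial F₀ hF₀
  have hMc := β.conj_mem_corner hg hg' hF₀
  obtain ⟨T, hT, hcomm⟩ := exists_diagonal_commute (g * F₀ * g') β.First
    (fun p q h => (hMc p q h).2.2) (fun p q h => (hM p q p.2 h).1)
  refine ⟨T, g, g', hT, hg, hg', h1, ?_⟩
  have hLevi : ∀ d : Fin n → K, g' * Matrix.diagonal d * g ∈ supported K β.Levi := fun d =>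
    mul_mem_supported (mul_mem_supported hg' (diagonal_mem_supported β.levi_refl d)
      fun _ _ _ => Levi.trans β) hg fun _ _ _ => Levi.trans β
  have hfix : ∀ d ∈ T, g' * Matrix.diagonal d * g * F₀ = F₀ * (g' * Matrix.diagonal d * g) := by
    intro d hd
    calc g' * Matrix.diagonal d * g * F₀
        = g' * (Matrix.diagonal d * (g * F₀ * g')) * g := by
          simp only [mul_assoc, h2, mul_one]
      _ = g' * ((g * F₀ * g') * Matrix.diagonal d) * g := by rw [hcomm d hd]
      _ = (g' * g) * F₀ * (g' * Matrix.diagonal d * g) := by simp only [mul_assoc]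
      _ = _ := by rw [h2, one_mul]
  have hLC : ∀ {t a : Matrix (Fin n) (Fin n) K}, t ∈ supported K β.Levi →
      a ∈ supported K β.Corner → t * a ∈ supported K β.Corner := by
    intro t a ht ha
    refine mul_mem_supported ht ha ?_
    rintro p q r ⟨h1, h2⟩ ⟨h3, h4, h5⟩
    exact ⟨h1.1.trans h3, fun h => h4 (h2.1 h), h5⟩
  have hCL : ∀ {t a : Matrix (Fin n) (Fin n) K}, t ∈ supported K β.Levi →
      a ∈ supported K β.Corner → a * t ∈ supported K β.Corner := by
    intro t a ht ha
    refine mul_mem_supported ha ht ?_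
    rintro p q r ⟨h3, h4, h5⟩ ⟨h1, h2⟩
    exact ⟨h3.trans h1.1, h4, h2.1 h5⟩
  have hCC : ∀ a ∈ supported K β.Corner, ∀ a' ∈ supported K β.Corner, a * a' = 0 :=
    fun a ha a' ha' => mul_eq_zero_of_mem_supported ha ha' fun p q r h h' => h'.2.1 h.2.2
  intro a ha a' ha' d hd d' hd'
  set t := g' * Matrix.diagonal d * g with ht
  set t' := g' * Matrix.diagonal d' * g with ht'
  have htt : t * t' = t' * t := by
    have : ∀ x y : Fin n → K, g' * Matrix.diagonal x * g * (g' * Matrix.diagonal y * g) =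
        g' * Matrix.diagonal (x * y) * g := by
      intro x y
      calc g' * Matrix.diagonal x * g * (g' * Matrix.diagonal y * g)
          = g' * Matrix.diagonal x * (g * g') * (Matrix.diagonal y * g) := by
            simp only [mul_assoc]
        _ = g' * (Matrix.diagonal x * Matrix.diagonal y) * g := by
            rw [h1, mul_one]
            simp only [mul_assoc]
        _ = _ := by rw [Matrix.diagonal_mul_diagonal]; rfl
    rw [ht, ht', this, this, mul_comm]
  -- The corner and the torus are both abelian, so only mixed brackets survive; the trace against
  -- `F₀` kills these because the torus commutes with `F₀`.
  have hbr : ⁅a + t, a' + t'⁆ = (a * t' - t' * a) + (t * a' - a' * t) := by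
    rw [Ring.lie_def]
    simp only [mul_add, add_mul, hCC a ha a' ha', hCC a' ha' a ha, htt]
    abel
  have hz : ∀ x ∈ supported K β.Corner, ∀ e ∈ T,
      (F₀ * (x * (g' * Matrix.diagonal e * g))).trace =
        (F₀ * (g' * Matrix.diagonal e * g * x)).trace := by
    intro x _ e he
    rw [← mul_assoc, Matrix.trace_mul_comm, ← mul_assoc, hfix e he, mul_assoc]
  rw [hbr, htr _ (add_mem (sub_mem (hCL (hLevi d') ha) (hLC (hLevi d') ha))
    (sub_mem (hLC (hLevi d) ha') (hCL (hLevi d) ha'))), mul_add, mul_sub, mul_sub,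
    Matrix.trace_add, Matrix.trace_sub, Matrix.trace_sub, hz a ha d' hd', hz a' ha' d hd]
  ring

/-- The identity matrix has nonzero trace in characteristic zero, so the trace condition is proper.
-/
theorem finrank_add_one_le [CharZero K] (L : LieSubalgebra K (Matrix (Fin n) (Fin n) K))
    (hL : ∀ X, X ∈ L ↔ X.trace = 0 ∧ X ∈ supported K β.Lower) (hn : n ≠ 0) :
    Module.finrank K L + 1 ≤
      (Finset.univ.filter fun x : Fin n × Fin n => β.Lower x.1 x.2).card := by
  rw [← finrank_supported (K := K)]
  refine Submodule.finrank_lt_finrank_of_lt (s := L.toSubmodule) ?_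
  refine lt_of_le_of_ne (fun X hX => ((hL X).1 hX).2) fun he => ?_
  have h1 : (1 : Matrix (Fin n) (Fin n) K) ∈ supported K β.Lower :=
    one_mem_supported fun p => ⟨rfl, le_rfl⟩
  rw [← he] at h1
  have := ((hL 1).1 h1).1
  rw [Matrix.trace_one, Fintype.card_fin] at this
  exact hn (by exact_mod_cast this)

/-- Restricting `V` to trace zero costs at most one dimension, which the doubled inequality records
as `+ 2`. -/
theorem two_mul_finrank_le_of_isotropic_matrices (L : LieSubalgebra K (Matrix (Fin n) (Fin n) K))
    (hL : ∀ X, X ∈ L ↔ X.trace = 0 ∧ X ∈ supported K β.Lower) (f : Module.Dual K L)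
    (F : Matrix (Fin n) (Fin n) K) (hF : ∀ X : L, f X = (F * X.1).trace)
    {V : Type*} [AddCommGroup V] [Module K V] [FiniteDimensional K V]
    (ψ : V →ₗ[K] Matrix (Fin n) (Fin n) K) (hψ : Function.Injective ψ)
    (hψL : ∀ v, ψ v ∈ supported K β.Lower) (hiso : ∀ v v', (F * ⁅ψ v, ψ v'⁆).trace = 0) :
    2 * Module.finrank K V ≤
      Module.finrank K L + Module.finrank K (LinearMap.ker (kirillovForm f)) + 2 := by
  let τ := Matrix.traceLinearMap (Fin n) K K ∘ₗ ψ
  have hU : Module.finrank K V ≤ Module.finrank K (LinearMap.ker τ) + 1 := by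
    have h1 := LinearMap.finrank_range_add_finrank_ker τ
    have h2 := Submodule.finrank_le (LinearMap.range τ)
    rw [Module.finrank_self] at h2
    omega
  have hmem : ∀ u : LinearMap.ker τ, (ψ ∘ₗ (LinearMap.ker τ).subtype) u ∈ L.toSubmodule :=
    fun u => (hL _).2 ⟨u.2, hψL u.1⟩
  let j : LinearMap.ker τ →ₗ[K] L := (ψ ∘ₗ (LinearMap.ker τ).subtype).codRestrict _ hmem
  have hjv : ∀ u, (j u).1 = ψ u.1 := fun u => rfl
  have hj : Function.Injective j := by
    intro x y hxy
    refine Subtype.ext (hψ ?_)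
    rw [← hjv, ← hjv, hxy]
  have key := two_mul_finrank_le_of_isotropic (kirillovForm f) j hj fun u u' => by
    have h : kirillovForm f (j u) (j u') = f ⁅j u, j u'⁆ := rfl
    rw [h, hF, LieSubalgebra.coe_bracket, hjv, hjv]
    exact hiso _ _
  omega

theorem le_finrank_ker_kirillovForm [CharZero K] (L : LieSubalgebra K (Matrix (Fin n) (Fin n) K))
    (hL : ∀ X, X ∈ L ↔ X.trace = 0 ∧ X ∈ supported K β.Lower) (hn : n ≠ 0)
    (f : Module.Dual K L) :
    (Finset.univ.filter fun p => ¬ β.First p).card ≤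
      Module.finrank K (LinearMap.ker (kirillovForm f)) + 1 := by
  obtain ⟨F, hF⟩ := exists_trace_mul_eq L.toSubmodule f
  obtain ⟨T, g, g', hT, hg, hg', hgg, hiso⟩ := β.exists_isotropic F
  have hLevi : ∀ d : Fin n → K, g' * Matrix.diagonal d * g ∈ supported K β.Levi := fun d =>
    mul_mem_supported (mul_mem_supported hg' (diagonal_mem_supported β.levi_refl d)
      fun _ _ _ => Levi.trans β) hg fun _ _ _ => Levi.trans β
  let ψ : (supported K β.Corner × T) →ₗ[K] Matrix (Fin n) (Fin n) K :=
    { toFun := fun x => x.1.1 + g' * Matrix.diagonal x.2.1 * g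
      map_add' := by
        intro x y
        have : Matrix.diagonal (x.2.1 + y.2.1) =
          Matrix.diagonal x.2.1 + Matrix.diagonal y.2.1 := (Matrix.diagonal_add _ _).symm
        simp only [Prod.fst_add, Prod.snd_add, Submodule.coe_add, this, mul_add, add_mul]
        abel
      map_smul' := by
        intro c x
        simp only [Prod.smul_fst, Prod.smul_snd, Submodule.coe_smul, Matrix.diagonal_smul,
          Matrix.mul_smul, Matrix.smul_mul, smul_add, RingHom.id_apply] }
  have hψ : Function.Injective ψ := by
    rw [← LinearMap.ker_eq_bot, LinearMap.ker_eq_bot']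
    rintro ⟨⟨a, ha⟩, ⟨d, hd⟩⟩ h
    have h' : a + g' * Matrix.diagonal d * g = 0 := h
    have ha0 : a = 0 := by
      ext p q
      by_cases hc : β.Corner p q
      · have h1 := congrFun (congrFun h' p) q
        have h2 := apply_eq_zero_of_mem_supported (hLevi d) (p := p) (q := q)
          fun hl => hc.2.1 (hl.2.2 hc.2.2)
        rwa [Matrix.add_apply, h2, add_zero] at h1
      · exact apply_eq_zero_of_mem_supported ha hc
    subst ha0
    rw [zero_add] at h'
    have hd0 : Matrix.diagonal d = 0 := by
      calc Matrix.diagonal d = (g * g') * Matrix.diagonal d * (g * g') := by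
            rw [hgg, one_mul, mul_one]
        _ = g * (g' * Matrix.diagonal d * g) * g' := by simp only [mul_assoc]
        _ = 0 := by rw [h', mul_zero, zero_mul]
    have : d = 0 := Matrix.diagonal_eq_zero.1 hd0
    subst this
    rfl
  have key := β.two_mul_finrank_le_of_isotropic_matrices L hL f F hF ψ hψ
    (fun v => add_mem (supported_mono (fun p q => β.lower_of_corner) v.1.2)
      (supported_mono (fun p q h => h.1) (hLevi v.2.1)))
    (fun v v' => hiso _ v.1.2 _ v'.1.2 _ v.2.2 _ v'.2.2)
  have hdim := β.finrank_add_one_le L hL hn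
  rw [β.card_lower] at hdim
  rw [Module.finrank_prod, finrank_supported] at key
  omega

end BlockReversal
end Index

/-! ### The upper bound from the arc form -/

section Index

variable {n : ℕ} {K : Type*} [Field K]

namespace BlockReversal

variable (β : BlockReversal (Fin n))

/-- The sum of the entries joining each element of a first half to its reflection. -/
def arcForm (K : Type*) [Field K] : Matrix (Fin n) (Fin n) K →ₗ[K] K :=
  ∑ p ∈ Finset.univ.filter β.First, Matrix.entryLinearMap K K (β.rev p) p

theorem arcForm_apply (X : Matrix (Fin n) (Fin n) K) :
    β.arcForm K X = ∑ p ∈ Finset.univ.filter β.First, X (β.rev p) p := by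
  simp [arcForm]

theorem arcForm_lie_single (X : Matrix (Fin n) (Fin n) K) (p q : Fin n) :
    β.arcForm K ⁅X, Matrix.single q p 1⁆ =
      (if β.First p then X (β.rev p) q else 0) -
        if β.First (β.rev q) then X p (β.rev q) else 0 := by
  rw [Ring.lie_def, map_sub, arcForm_apply, arcForm_apply]
  congr 1
  · rw [Finset.sum_filter, Finset.sum_eq_single p]
    · simp
    · intro a _ ha
      rw [Matrix.mul_single_apply_of_ne _ _ _ _ _ ha, ite_self]
    · simp
  · rw [Finset.sum_filter, Finset.sum_eq_single (β.rev q)]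
    · simp [β.rev_rev]
    · intro a _ ha
      rw [Matrix.single_mul_apply_of_ne, ite_self]
      rintro rfl
      exact ha (β.rev_rev a).symm
    · simp

/-- In a matrix annihilated by the arc form, reflected entries agree, and the entries off the
diagonal vanish. -/
theorem diagonal_of_arcForm_lie_eq_zero {X : Matrix (Fin n) (Fin n) K}
    (hX : X ∈ supported K β.Lower)
    (h : ∀ Y ∈ supported K β.Lower, β.arcForm K ⁅X, Y⁆ = 0) :
    (∀ u v, u ≠ v → X u v = 0) ∧ ∀ u, X (β.rev u) (β.rev u) = X u u := by
  -- Testing against one matrix unit. For each entry below the diagonal inside a block, a suitable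
  -- choice of `p`, `q` equates it with zero or with an entry above the diagonal.
  have key : ∀ p q, β.block p = β.block q → p ≤ q →
      (if β.First p then X (β.rev p) q else 0) =
        if β.First (β.rev q) then X p (β.rev q) else 0 := by
    intro p q hb hpq
    have := h _ (single_mem_supported (R := β.Lower) (p := q) (q := p) ⟨hb.symm, hpq⟩ 1)
    rw [β.arcForm_lie_single] at this
    exact sub_eq_zero.1 this
  have hlt : ∀ u v, u < v → X u v = 0 := fun u v huv =>
    apply_eq_zero_of_mem_supported hX fun hl => absurd hl.2 (not_le.2 huv)
  have hdiag : ∀ u, β.First u → X (β.rev u) (β.rev u) = X u u := by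
    intro u hu
    have := key u (β.rev u) (β.block_rev u).symm (le_of_lt hu)
    rwa [if_pos hu, β.rev_rev, if_pos hu] at this
  refine ⟨?_, ?_⟩
  · intro u v hne
    rcases lt_or_gt_of_ne hne with huv | hvu
    · exact hlt u v huv
    by_cases hb : β.block u = β.block v
    swap
    · exact apply_eq_zero_of_mem_supported hX fun hl => hb hl.1
    have hrev := β.rev_lt_rev hb.symm hvu
    have hbu := β.block_rev u
    have hbv := β.block_rev v
    rcases le_or_gt u (β.rev u) with hu | hu
    · have hv : v < β.rev v := hvu.trans_le (hu.trans hrev.le)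
      have hk := key u (β.rev v) (hb.trans hbv.symm) (hu.trans hrev.le)
      rw [β.rev_rev, if_pos (show β.First v from hv), hlt _ _ hrev, ite_self] at hk
      exact hk.symm
    · rcases le_or_gt (β.rev u) v with huv | huv
      · have hk := key (β.rev u) v (hbu.trans hb) huv
        rw [hlt _ _ hrev, ite_self, if_pos, β.rev_rev] at hk
        · exact hk
        · rw [First, β.rev_rev]
          exact hu
      · have huv' : u < β.rev v := by
          have := β.rev_lt_rev (a := v) (b := β.rev u) (hb.symm.trans hbu.symm) huv
          rwa [β.rev_rev] at this
        have hk := key u (β.rev v) (hb.trans hbv.symm) huv'.le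
        rw [if_neg (show ¬ β.First u from not_lt.2 hu.le), β.rev_rev,
          if_pos (show β.First v from hvu.trans huv')] at hk
        exact hk.symm
  · intro u
    rcases lt_trichotomy u (β.rev u) with hu | hu | hu
    · exact hdiag u hu
    · rw [← hu]
    · have := hdiag (β.rev u) (by rw [First, β.rev_rev]; exact hu)
      rw [β.rev_rev] at this
      exact this.symm

variable [CharZero K]

theorem finrank_ker_kirillovForm_arcForm_lt (L : LieSubalgebra K (Matrix (Fin n) (Fin n) K))
    (hL : ∀ X, X ∈ L ↔ X.trace = 0 ∧ X ∈ supported K β.Lower) (hn : n ≠ 0) :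
    Module.finrank K (LinearMap.ker
      (kirillovForm (K := K) (L := L) (β.arcForm K ∘ₗ L.toSubmodule.subtype))) <
      (Finset.univ.filter fun p => ¬ β.First p).card := by
  set N := LinearMap.ker
      (kirillovForm (K := K) (L := L) (β.arcForm K ∘ₗ L.toSubmodule.subtype)) with hN
  have hn' : (n : K) ≠ 0 := by exact_mod_cast hn
  have hdiag : ∀ X : N, (∀ u v, u ≠ v → X.1.1 u v = 0) ∧
      ∀ u, X.1.1 (β.rev u) (β.rev u) = X.1.1 u u := by
    intro X
    refine β.diagonal_of_arcForm_lie_eq_zero ((hL _).1 X.1.2).2 fun Y hY => ?_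
    -- Subtracting a scalar matrix makes the trace zero without changing brackets, so kernel
    -- elements can be tested against all triangular matrices.
    have hY' : Y - (Y.trace / n) • (1 : Matrix (Fin n) (Fin n) K) ∈ L := by
      refine (hL _).2 ⟨?_, sub_mem hY (Submodule.smul_mem _ _ (one_mem_supported fun p =>
        ⟨rfl, le_rfl⟩))⟩
      rw [Matrix.trace_sub, Matrix.trace_smul, Matrix.trace_one, Fintype.card_fin, smul_eq_mul,
        div_mul_cancel₀ _ hn', sub_self]
    have h0 : kirillovForm (K := K) (L := L) (β.arcForm K ∘ₗ L.toSubmodule.subtype) X.1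
        ⟨_, hY'⟩ = 0 := by
      rw [LinearMap.mem_ker.1 X.2]
      rfl
    have h1 : β.arcForm K ⁅X.1.1, Y - (Y.trace / n) • (1 : Matrix (Fin n) (Fin n) K)⁆ = 0 := h0
    rw [← h1]
    congr 1
    simp only [Ring.lie_def, mul_sub, sub_mul, mul_smul_comm, smul_mul_assoc, mul_one, one_mul]
    abel
  let δ : N →ₗ[K] ({p // ¬ β.First p} → K) :=
    { toFun := fun X p => X.1.1 p.1 p.1
      map_add' := fun _ _ => rfl
      map_smul' := fun _ _ => rfl }
  have hent : ∀ X : N, ∀ c : K, (∀ p, δ X p = c) → X.1.1 = Matrix.diagonal fun _ => c := by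
    intro X c hc
    ext u v
    by_cases huv : u = v
    · subst huv
      rw [Matrix.diagonal_apply_eq]
      by_cases hu : β.First u
      · rw [← (hdiag X).2 u]
        refine hc ⟨β.rev u, ?_⟩
        rw [First, β.rev_rev]
        exact not_lt.2 (le_of_lt hu)
      · exact hc ⟨u, hu⟩
    · rw [(hdiag X).1 u v huv, Matrix.diagonal_apply_ne _ huv]
  have hinj : Function.Injective δ := by
    rw [← LinearMap.ker_eq_bot, LinearMap.ker_eq_bot']
    intro X hX
    have := hent X 0 fun p => congrFun hX p
    refine Subtype.ext (Subtype.ext ?_)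
    rw [this]
    exact Matrix.diagonal_zero
  -- The constant vector `1` would come from the identity matrix, whose trace is not zero. This
  -- gains the strict inequality.
  have hrange : LinearMap.range δ ≠ ⊤ := by
    intro htop
    obtain ⟨X, hX⟩ : (fun _ => 1) ∈ LinearMap.range δ := htop ▸ Submodule.mem_top
    have h1 := hent X 1 fun p => congrFun hX p
    have h2 := ((hL _).1 X.1.2).1
    rw [h1, Matrix.trace_diagonal] at h2
    simp at h2
    exact hn h2
  have := Submodule.finrank_lt hrange
  rwa [LinearMap.finrank_range_of_inj hinj, Module.finrank_fintype_fun_eq_card,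
    Fintype.card_subtype] at this

theorem lieIndex_add_one (L : LieSubalgebra K (Matrix (Fin n) (Fin n) K))
    (hL : ∀ X, X ∈ L ↔ X.trace = 0 ∧ X ∈ supported K β.Lower) (hn : n ≠ 0) :
    lieIndex K L + 1 = (Finset.univ.filter fun p => ¬ β.First p).card := by
  have h1 : lieIndex K L ≤ _ := ciInf_le' _ (β.arcForm K ∘ₗ L.toSubmodule.subtype)
  have h2 := β.finrank_ker_kirillovForm_arcForm_lt L hL hn
  have h3 : (Finset.univ.filter fun p => ¬ β.First p).card - 1 ≤ lieIndex K L :=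
    le_ciInf fun f => by
      have := β.le_finrank_ker_kirillovForm L hL hn f
      omega
  omega

end BlockReversal
end Index

/-! ### Seaweeds of type `λ_1|⋯|λ_m / 1|⋯|1` -/

theorem mem_span_single_iff {n : ℕ} (s : Fin n → Prop) (v : Fin n → ℂ) :
    v ∈ Submodule.span ℂ {v : Fin n → ℂ | ∃ k : Fin n, s k ∧ v = Pi.single k 1} ↔
      ∀ k, v k ≠ 0 → s k := by
  constructor
  · intro hv
    induction hv using Submodule.span_induction with
    | mem x hx =>
      obtain ⟨k, hk, rfl⟩ := hx
      intro k' hk'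
      by_cases h : k' = k
      · rwa [h]
      · exact absurd (Pi.single_eq_of_ne h _) hk'
    | zero => intro k hk; exact absurd rfl hk
    | add x y _ _ hx hy =>
      intro k hk
      by_contra h
      refine hk ?_
      rw [Pi.add_apply, not_not.1 (mt (hx k) h), not_not.1 (mt (hy k) h), add_zero]
    | smul c x _ hx =>
      intro k hk
      by_contra h
      refine hk ?_
      rw [Pi.smul_apply, not_not.1 (mt (hx k) h), smul_zero]
  · intro hv
    rw [pi_eq_sum_univ v]
    refine Submodule.sum_mem _ fun k _ => ?_
    by_cases h : v k = 0
    · rw [h, zero_smul]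
      exact zero_mem _
    · refine Submodule.smul_mem _ _ (Submodule.subset_span ⟨k, hv k h, ?_⟩)
      ext j
      simp [Pi.single_apply, eq_comm]

theorem mulVec_mem_span_single_iff {n : ℕ} (s : Fin n → Prop) (A : Matrix (Fin n) (Fin n) ℂ) :
    (∀ v ∈ Submodule.span ℂ {v : Fin n → ℂ | ∃ k : Fin n, s k ∧ v = Pi.single k 1},
      A.mulVec v ∈ Submodule.span ℂ {v : Fin n → ℂ | ∃ k : Fin n, s k ∧ v = Pi.single k 1}) ↔
      ∀ p q, A p q ≠ 0 → s q → s p := by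
  simp only [mem_span_single_iff]
  constructor
  · intro h p q hpq hq
    refine h (Pi.single q 1) ?_ p ?_
    · intro k hk
      by_cases hkq : k = q
      · rwa [hkq]
      · exact absurd (Pi.single_eq_of_ne hkq _) hk
    · simpa using hpq
  · intro h v hv p hp
    rw [Matrix.mulVec, dotProduct] at hp
    obtain ⟨q, -, hq⟩ := Finset.exists_ne_zero_of_sum_ne_zero hp
    exact h p q (left_ne_zero_of_mul hq) (hv q (right_ne_zero_of_mul hq))

theorem rev_embedding {n : ℕ} (c : Composition n) (i : Fin c.length)
    (x : Fin (c.blocksFun i)) :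
    c.embedding (c.index (c.embedding i x)) (c.invEmbedding (c.embedding i x)).rev =
      c.embedding i x.rev := by
  have hi := c.index_embedding i x
  have hb : c.blocksFun (c.index (c.embedding i x)) = c.blocksFun i := by rw [hi]
  ext
  rw [Composition.coe_embedding, Composition.coe_embedding, Fin.val_rev, Fin.val_rev,
    c.coe_invEmbedding, hb, hi, Composition.coe_embedding]
  omega

/-- The reflection of every block of a composition. -/
def blockReversal {n : ℕ} (c : Composition n) : BlockReversal (Fin n) where
  block p := c.index p
  rev p := c.embedding (c.index p) (c.invEmbedding p).rev
  rev_rev p := by rw [rev_embedding, Fin.rev_rev, c.embedding_comp_inv]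
  block_rev p := by rw [c.index_embedding]
  rev_le_rev p q h hpq := by
    have hi : c.index p = c.index q := Fin.ext h
    rw [Fin.le_def, Composition.coe_embedding, Composition.coe_embedding, Fin.val_rev, Fin.val_rev,
      Composition.coe_invEmbedding, Composition.coe_invEmbedding, hi]
    rw [Fin.le_def] at hpq
    omega

/-- The lower flag gives `q ≤ p` at a nonzero entry, the upper flag gives that the block of `p` is
not after that of `q`; block indices being monotone, the blocks coincide. -/
theorem mem_seaweed_ones_iff {n : ℕ} (c : Composition n) (A : Matrix (Fin n) (Fin n) ℂ) :
    A ∈ seaweed c (Composition.ones n) ↔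
      A.trace = 0 ∧ A ∈ supported ℂ (blockReversal c).Lower := by
  have h0 : A ∈ seaweed c (Composition.ones n) ↔
      A ∈ LieAlgebra.SpecialLinear.sl (Fin n) ℂ ∧
      (∀ i ≤ c.length, ∀ v ∈ topFlag c i, A.mulVec v ∈ topFlag c i) ∧
      (∀ j ≤ (Composition.ones n).length, ∀ v ∈ bottomFlag (Composition.ones n) j,
        A.mulVec v ∈ bottomFlag (Composition.ones n) j) := Iff.rfl
  have h1 : A ∈ LieAlgebra.SpecialLinear.sl (Fin n) ℂ ↔ A.trace = 0 := Iff.rfl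
  have hmono : ∀ p q : Fin n, p ≤ q → c.index p ≤ c.index q := by
    intro p q hpq
    by_contra h
    have h2 := c.lt_sizeUpTo_index_succ q
    have h3 := c.sizeUpTo_index_le p
    have h4 : c.sizeUpTo (c.index q).succ ≤ c.sizeUpTo (c.index p) :=
      c.monotone_sizeUpTo (by
        rw [not_le, Fin.lt_def] at h
        rw [Fin.val_succ]
        omega)
    rw [Fin.le_def] at hpq
    omega
  rw [h0, h1]
  refine and_congr_right fun _ => ?_
  simp only [topFlag, bottomFlag, mulVec_mem_span_single_iff, Composition.ones_length,
    Composition.ones_sizeUpTo, mem_supported]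
  constructor
  · rintro ⟨ht, hb⟩ p q hpq
    have hqp : q ≤ p := by
      have := hb q q.2.le p q hpq (by simp)
      rw [Fin.le_def]
      have := q.2
      omega
    refine ⟨?_, hqp⟩
    have h2 := ht (c.index q).succ (by
      rw [Fin.val_succ]
      exact (c.index q).2) p q hpq (c.lt_sizeUpTo_index_succ q)
    have h3 := hmono q p hqp
    by_contra hne
    have h4 : c.sizeUpTo (c.index q).succ ≤ c.sizeUpTo (c.index p) :=
      c.monotone_sizeUpTo (by
        have hne' : (c.index p : ℕ) ≠ c.index q := hne
        rw [Fin.le_def] at h3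
        rw [Fin.val_succ]
        omega)
    have h5 := c.sizeUpTo_index_le p
    omega
  · intro h
    refine ⟨fun i _ p q hpq hq => ?_, fun j _ p q hpq hq => ?_⟩
    · have hi : c.index p = c.index q := Fin.ext (h p q hpq).1
      have h2 := c.lt_sizeUpTo_index_succ p
      have h3 := c.sizeUpTo_index_le q
      by_contra hlt
      have h4 : (c.index q : ℕ) < i := by
        by_contra hle
        have := c.monotone_sizeUpTo (not_lt.1 hle)
        omega
      have h5 := c.monotone_sizeUpTo (show (c.index p).succ.val ≤ i by
        rw [hi, Fin.val_succ]
        omega)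
      omega
    · exact hq.trans (h p q hpq).2

/-! ### The index formula and the count -/

theorem card_filter_lt_rev (k : ℕ) :
    (Finset.univ.filter fun x : Fin k => x < x.rev).card = k / 2 := by
  have : (Finset.univ.filter fun x : Fin k => x < x.rev) =
      Finset.univ.filter fun x : Fin k => (x : ℕ) < k / 2 := by
    refine Finset.filter_congr fun x _ => ?_
    rw [Fin.lt_def, Fin.val_rev]
    omega
  rw [this, Fin.card_filter_val_lt]
  omega

theorem card_filter_first {n : ℕ} (c : Composition n) :
    (Finset.univ.filter (blockReversal c).First).card = (c.blocks.map (· / 2)).sum := by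
  rw [Finset.card_filter, ← Equiv.sum_comp c.blocksFinEquiv, Fintype.sum_sigma]
  have h : ∀ i : Fin c.length, (∑ x : Fin (c.blocksFun i),
      if (blockReversal c).First (c.blocksFinEquiv ⟨i, x⟩) then 1 else 0) =
        c.blocksFun i / 2 := by
    intro i
    rw [← card_filter_lt_rev, Finset.card_filter]
    refine Finset.sum_congr rfl fun x _ => if_congr ?_ rfl rfl
    have : c.blocksFinEquiv ⟨i, x⟩ = c.embedding i x := rfl
    rw [this, BlockReversal.First, show (blockReversal c).rev (c.embedding i x) = _ from
      rev_embedding c i x]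
    exact (c.embedding i).lt_iff_lt
  simp only [h]
  rw [← c.ofFn_blocksFun, List.map_ofFn, List.sum_ofFn]
  rfl

theorem onesIndex_add_one_add {n : ℕ} (hn : n ≠ 0) (p : n.Partition) :
    onesIndex p + 1 + (p.parts.map (· / 2)).sum = n := by
  have h1 := (blockReversal (toComposition p)).lieIndex_add_one
    (seaweed (toComposition p) (Composition.ones n)) (mem_seaweed_ones_iff _) hn
  have h2 := card_filter_first (toComposition p)
  have h3 : ((toComposition p).blocks.map (· / 2)).sum = (p.parts.map (· / 2)).sum := by
    rw [toComposition, ← Multiset.sum_coe, ← Multiset.map_coe, Multiset.sort_eq]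
  have h4 := Finset.card_filter_add_card_filter_not (s := Finset.univ)
    (blockReversal (toComposition p)).First
  rw [Finset.card_univ, Fintype.card_fin] at h4
  rw [onesIndex]
  omega

theorem onesCount_eq (i n : ℕ) (hi : 1 ≤ i) (hn : 1 ≤ n) (h : 3 * i - 3 ≤ n) :
    onesCount i n = (twoKindPartitions (i - 1)).ncard := by
  rw [← card_filter_sum_half n (i - 1) (by omega), onesCount]
  congr 1
  refine Finset.filter_congr fun p _ => ?_
  have := onesIndex_add_one_add (by omega) p
  omega

end Seaweed

end

theorem theorem3p1 :
    ∃ c : ℕ → ℕ,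
      (∀ i n : ℕ, 1 ≤ i → 1 ≤ n → 3 * i - 3 ≤ n → Seaweed.onesCount i n = c i) ∧
      HasProd (fun m : ℕ => ((1 - (PowerSeries.X : PowerSeries ℚ) ^ (m + 1)) ^ 2)⁻¹)
        (PowerSeries.mk fun k : ℕ => (c (k + 1) : ℚ)) ∧
      (∀ i : ℕ, 1 ≤ i → c i = (Seaweed.twoKindPartitions (i - 1)).ncard) := by
  refine ⟨fun i => (Seaweed.twoKindPartitions (i - 1)).ncard, Seaweed.onesCount_eq, ?_,
    fun _ _ => rfl⟩
  simp only [Nat.add_sub_cancel]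
  rw [Seaweed.powerSeriesMk_ncard_twoKindPartitions]
  exact Seaweed.hasProd_partition_sq
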